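/- Let $d \neq 1$ be a squarefree integer, let $F = \mathbb{Q}(\sqrt{d})$, and let $\Delta_F$ be the discriminant of $F$. Let $\ell$ be an odd prime and let $K$ be an extension of $F$ such that one of the following holds: (a) $K/\mathbb{Q}$ is a Galois extension whose Galois group is the dihedral group of order $2\ell$, and $[K:F] = \ell$; or (b) $\ell$ divides the class number of $F$, and $K/F$ is an abelian extension of degree $\ell^n$ for some $n \ge 1$, unramified at every prime of $F$. Let $p$ and $q$ be distinct odd prime numbers with $p \equiv q \equiv 3 \pmod 4$ and $\left(\frac{q}{p}\right) \neq 1$ (Legendre symbol). Let $H_K(p,q)$ be the quaternion algebra over $K$ generated by $i, j$ with $i^2 = p$, $j^2 = q$, $ij = -ji$. Then $H_K(p,q)$ is a division algebra if and only if $\left(\frac{\Delta_F}{p}\right) = 1$ or $d \equiv 1 \pmod 8$. -/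

import Mathlib

open scoped NumberField Quaternion

/-- A nontrivial ring is a division algebra if, for `a ≠ 0`, each of the equations
`a * x = b` and `y * a = b` has exactly one solution. -/
def IsDivisionAlgebra (A : Type*) [Ring A] : Prop :=
  Nontrivial A ∧ ∀ a b : A, a ≠ 0 → (∃! x : A, a * x = b) ∧ (∃! y : A, y * a = b)

/-- `F = ℚ(√d)`: the field `F` is generated over `ℚ` by a square root of `d`. -/
def IsRatAdjoinSqrt (F : Type*) [Field F] [NumberField F] (d : ℤ) : Prop :=
  ∃ δ : F, δ ^ 2 = (d : F) ∧ IntermediateField.adjoin ℚ {δ} = ⊤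

/-- `K` is a dihedral extension of `ℚ` (Galois, with group dihedral of order `2 * ℓ`)
which has degree `ℓ` over `F`. -/
def IsDihedralOver (F K : Type*) [Field F] [NumberField F] [Field K] [NumberField K]
    [Algebra F K] (ℓ : ℕ) : Prop :=
  IsGalois ℚ K ∧ Nonempty ((K ≃ₐ[ℚ] K) ≃* DihedralGroup ℓ) ∧ Module.finrank F K = ℓ

/-- `ℓ` divides the class number of `F`, and `K` is an abelian extension of `F` of degree
`ℓ ^ n` for some `n ≥ 1`, unramified at all primes of `F`. -/
def IsUnramifiedAbelianEllExtension (F K : Type*) [Field F] [NumberField F] [Field K]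
    [NumberField K] [Algebra F K] (ℓ : ℕ) : Prop :=
  ℓ ∣ NumberField.classNumber F ∧ IsAbelianGalois F K ∧
    (∃ n : ℕ, 1 ≤ n ∧ Module.finrank F K = ℓ ^ n) ∧ Algebra.Unramified (𝓞 F) (𝓞 K)

/-! The reduced norm shows that the algebra is division exactly when `q` is not a value of `x ^ 2 -
p * y ^ 2` over `K`. Both kinds of extension have odd degree over `F`, and a determinant argument
(`exists_sq_sub_mul_sq_pow_finrank`) brings the question down to `F`.

If `p` splits in `F`, or `d ≡ 1` modulo `8`, then `F` embeds in `ℚ_[p]` or `ℚ_[2]`, where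
congruences show that `q` is not a value.

Otherwise `q` is a value, and it is enough that `-1` is one: Legendre's theorem makes `-q` times a
nonzero square a value over `ℚ` (or makes `p` a square), and nonzero values form a group. For `-1`,
one solves `x ^ 2 + d * y ^ 2 = p * m * z ^ 2` with `m` a sum of two squares. Over `F` the left side
is also a sum of two squares, hence so is `p` times a square. The factor `m` is a prime from
Dirichlet's theorem, or twice one, fitted to Legendre's local conditions; only `d ≡ 1` modulo `8` or
`(d/p) = 1` prevents the fit. -/

/-! ### Quaternion algebras and their norm form -/

theorem QuaternionAlgebra.mul_star_eq_coe_norm {K : Type*} [Field K] (a b : K) (v : ℍ[K, a, b]) :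
    v * star v = ((v.re ^ 2 - a * v.imI ^ 2 - b * (v.imJ ^ 2 - a * v.imK ^ 2) : K) : ℍ[K, a, b]) := by
  ext <;> simp only [QuaternionAlgebra.re_mul, QuaternionAlgebra.imI_mul,
    QuaternionAlgebra.imJ_mul, QuaternionAlgebra.imK_mul, QuaternionAlgebra.re_star,
    QuaternionAlgebra.imI_star, QuaternionAlgebra.imJ_star, QuaternionAlgebra.imK_star,
    QuaternionAlgebra.re_coe, QuaternionAlgebra.imI_coe, QuaternionAlgebra.imJ_coe,
    QuaternionAlgebra.imK_coe] <;> ring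

theorem QuaternionAlgebra.star_mul_eq_coe_norm {K : Type*} [Field K] (a b : K) (v : ℍ[K, a, b]) :
    star v * v = ((v.re ^ 2 - a * v.imI ^ 2 - b * (v.imJ ^ 2 - a * v.imK ^ 2) : K) : ℍ[K, a, b]) := by
  ext <;> simp only [QuaternionAlgebra.re_mul, QuaternionAlgebra.imI_mul,
    QuaternionAlgebra.imJ_mul, QuaternionAlgebra.imK_mul, QuaternionAlgebra.re_star,
    QuaternionAlgebra.imI_star, QuaternionAlgebra.imJ_star, QuaternionAlgebra.imK_star,
    QuaternionAlgebra.re_coe, QuaternionAlgebra.imI_coe, QuaternionAlgebra.imJ_coe,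
    QuaternionAlgebra.imK_coe] <;> ring

/-- If `a` is a nonzero square and `2 ≠ 0`, the form `x ^ 2 - a * y ^ 2` is universal. -/
theorem exists_sq_sub_mul_sq_of_isSquare {K : Type*} [Field K] (h2 : (2 : K) ≠ 0) {a : K}
    (ha : a ≠ 0) (hsq : IsSquare a) (b : K) : ∃ x y : K, x ^ 2 - a * y ^ 2 = b := by
  obtain ⟨s, rfl⟩ := hsq
  have hs : s ≠ 0 := fun h => ha (by simp [h])
  -- Solves `x + s * y = b`, `x - s * y = 1`.
  refine ⟨(b + 1) / 2, (b - 1) / (2 * s), ?_⟩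
  field_simp
  ring

theorem sq_sub_mul_sq_ne_zero {K : Type*} [Field K] {a x y : K} (ha : ¬ IsSquare a)
    (h : x ^ 2 - a * y ^ 2 = 0) : x = 0 ∧ y = 0 := by
  have hy : y = 0 := by
    by_contra hy
    exact ha ⟨x / y, by field_simp; linear_combination -h⟩
  subst hy
  exact ⟨by simpa using h, rfl⟩

/-- The values of `x ^ 2 - a * y ^ 2` are closed under division. -/
theorem exists_sq_sub_mul_sq_of_mul {K : Type*} [Field K] {a b x y z w : K}
    (hzw : z ^ 2 - a * w ^ 2 ≠ 0) (h : x ^ 2 - a * y ^ 2 = b * (z ^ 2 - a * w ^ 2)) :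
    ∃ u v : K, u ^ 2 - a * v ^ 2 = b := by
  -- The coordinates of `(x + y√a) / (z + w√a)`.
  refine ⟨(x * z - a * y * w) / (z ^ 2 - a * w ^ 2), (y * z - x * w) / (z ^ 2 - a * w ^ 2), ?_⟩
  field_simp
  linear_combination (z ^ 2 - a * w ^ 2) * h

/-- A representation of `b` makes `x + y i + j` an element of norm zero. Conversely, a nonzero
element of norm zero gives `b` as a quotient of two values of the form, and without one every
nonzero `u` has inverse `star u / N`. -/
theorem isDivisionAlgebra_quaternionAlgebra_iff {K : Type*} [Field K] (h2 : (2 : K) ≠ 0) {a : K}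
    (ha : a ≠ 0) (b : K) :
    IsDivisionAlgebra ℍ[K, a, b] ↔ ¬ ∃ x y : K, x ^ 2 - a * y ^ 2 = b := by
  constructor
  · rintro ⟨-, h⟩ ⟨x, y, hxy⟩
    let v : ℍ[K, a, b] := ⟨x, y, 1, 0⟩
    have hv : v ≠ 0 := fun h0 => one_ne_zero (α := K) (congrArg QuaternionAlgebra.imJ h0)
    have hv' : star v ≠ 0 := by simpa using hv
    obtain ⟨u, -, hu⟩ := (h v 0 hv).1
    have h1 : v * star v = 0 := by
      rw [QuaternionAlgebra.mul_star_eq_coe_norm]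
      have : (x ^ 2 - a * y ^ 2 - b * (1 ^ 2 - a * 0 ^ 2) : K) = 0 := by rw [hxy]; ring
      change ((x ^ 2 - a * y ^ 2 - b * (1 ^ 2 - a * 0 ^ 2) : K) : ℍ[K, a, b]) = 0
      rw [this]; rfl
    exact hv' ((hu _ h1).trans (hu 0 (mul_zero v)).symm)
  · intro hno
    have hsq : ¬ IsSquare a := fun h => hno (exists_sq_sub_mul_sq_of_isSquare h2 ha h b)
    refine ⟨inferInstance, fun u c hu => ?_⟩
    set N := u.re ^ 2 - a * u.imI ^ 2 - b * (u.imJ ^ 2 - a * u.imK ^ 2) with hN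
    have hN0 : N ≠ 0 := by
      intro h0
      by_cases hzw : u.imJ ^ 2 - a * u.imK ^ 2 = 0
      · obtain ⟨h3, h4⟩ := sq_sub_mul_sq_ne_zero hsq hzw
        rw [hN, hzw] at h0
        obtain ⟨h5, h6⟩ := sq_sub_mul_sq_ne_zero hsq (by simpa using h0)
        exact hu (by ext <;> simp [*])
      · exact hno (exists_sq_sub_mul_sq_of_mul hzw (x := u.re) (y := u.imI)
          (by linear_combination h0))
    have hr : u * ((N⁻¹ : K) • star u) = 1 := by
      rw [mul_smul_comm, QuaternionAlgebra.mul_star_eq_coe_norm, ← hN, ← QuaternionAlgebra.coe_smul,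
        smul_eq_mul, inv_mul_cancel₀ hN0]; rfl
    have hl : ((N⁻¹ : K) • star u) * u = 1 := by
      rw [smul_mul_assoc, QuaternionAlgebra.star_mul_eq_coe_norm, ← hN,
        ← QuaternionAlgebra.coe_smul, smul_eq_mul, inv_mul_cancel₀ hN0]; rfl
    refine ⟨⟨((N⁻¹ : K) • star u) * c, ?_, fun x hx => ?_⟩,
      ⟨c * ((N⁻¹ : K) • star u), ?_, fun x hx => ?_⟩⟩
    · change u * _ = c
      rw [← mul_assoc, hr, one_mul]
    · rw [← hx, ← mul_assoc, hl, one_mul]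
    · change _ * u = c
      rw [mul_assoc, hl, mul_one]
    · rw [← hx, mul_assoc, hr, mul_one]

/-! ### Descent through extensions of odd degree -/

theorem exists_sq_sub_mul_sq_of_pow_odd {F : Type*} [Field F] {a b : F} (hb : b ≠ 0) {n : ℕ}
    (hn : Odd n) (h : ∃ x y : F, x ^ 2 - a * y ^ 2 = b ^ n) : ∃ x y : F, x ^ 2 - a * y ^ 2 = b := by
  obtain ⟨k, rfl⟩ := hn
  obtain ⟨x, y, h⟩ := h
  refine ⟨x / b ^ k, y / b ^ k, ?_⟩
  field_simp
  rw [h]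
  ring

/-- In an extension of finite degree `n`, a value `b` of `x ^ 2 - a * y ^ 2` that lies in the base
field has `b ^ n` as a value over the base field. -/
theorem exists_sq_sub_mul_sq_pow_finrank {F K : Type*} [Field F] [Field K] [Algebra F K]
    [FiniteDimensional F K] {a b : F}
    (h : ∃ x y : K, x ^ 2 - algebraMap F K a * y ^ 2 = algebraMap F K b) :
    ∃ x y : F, x ^ 2 - a * y ^ 2 = b ^ Module.finrank F K := by
  obtain ⟨x, y, hxy⟩ := h
  let B := Module.finBasis F K
  -- With `ω ^ 2 = a`, the commuting matrices satisfy `(X + ωY)(X - ωY) = b`. The two factors are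
  -- conjugate, so taking determinants exhibits `b ^ n` as a norm from `F[ω]`. Nothing requires
  -- `F[ω]` to be a field.
  let X := Algebra.leftMulMatrix B x
  let Y := Algebra.leftMulMatrix B y
  let f : F →+* QuadraticAlgebra F a 0 := algebraMap F _
  let ω : QuadraticAlgebra F a 0 := ⟨0, 1⟩
  have hXY : X * X - a • (Y * Y) = b • (1 : Matrix _ _ F) := by
    have := congrArg (Algebra.leftMulMatrix B) hxy
    simpa [X, Y, Algebra.algebraMap_eq_smul_one, pow_two] using this
  have hcomm : X * Y = Y * X := by
    simp only [X, Y, ← map_mul, mul_comm]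
  have hω : ω * ω = f a := by
    ext <;> simp [ω, f, QuadraticAlgebra.algebraMap_eq]
  have hf (r : F) : star (f r) = f r := by
    ext <;> simp [f, QuadraticAlgebra.algebraMap_eq]
  have hωs : star ω = -ω := by
    ext <;> simp [ω]
  have hstar : (starRingEnd (QuadraticAlgebra F a 0)).mapMatrix (X.map f + ω • Y.map f) =
      X.map f - ω • Y.map f := by
    ext1 i j
    simp [starRingEnd_apply, hf, hωs, sub_eq_add_neg]
  have hc : X.map f * Y.map f = Y.map f * X.map f := by
    simp only [← Matrix.map_mul, hcomm]
  have hprod : (X.map f + ω • Y.map f) * (X.map f - ω • Y.map f) =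
      f.mapMatrix (b • (1 : Matrix _ _ F)) := by
    have e1 : f.mapMatrix (X * X - a • (Y * Y)) =
        X.map f * X.map f - (ω * ω) • (Y.map f * Y.map f) := by
      rw [hω, ← Matrix.map_mul, ← Matrix.map_mul]
      ext1 i j
      simp [Matrix.map_apply, -Matrix.map_mul]
    rw [← hXY, e1, add_mul, mul_sub, mul_sub, smul_mul_assoc, smul_mul_assoc, mul_smul_comm, hc,
      mul_smul_comm, smul_smul]
    abel
  have hdet := congrArg Matrix.det hprod
  rw [Matrix.det_mul, ← hstar, ← RingHom.map_det, ← RingHom.map_det, Matrix.det_smul,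
    Matrix.det_one, mul_one, Fintype.card_fin, starRingEnd_apply] at hdet
  generalize (X.map f + ω • Y.map f).det = D at hdet
  refine ⟨D.re, D.im, ?_⟩
  have := congrArg QuadraticAlgebra.re hdet
  rw [QuadraticAlgebra.re_mul, QuadraticAlgebra.re_star, QuadraticAlgebra.im_star] at this
  change _ = b ^ _ at this
  rw [← this]
  ring

theorem exists_sq_sub_mul_sq_iff_of_odd_finrank {F K : Type*} [Field F] [Field K] [Algebra F K]
    (hodd : Odd (Module.finrank F K)) (a b : F) :
    (∃ x y : K, x ^ 2 - algebraMap F K a * y ^ 2 = algebraMap F K b) ↔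
      ∃ x y : F, x ^ 2 - a * y ^ 2 = b := by
  have : FiniteDimensional F K := FiniteDimensional.of_finrank_pos hodd.pos
  constructor
  · intro h
    rcases eq_or_ne b 0 with rfl | hb
    · exact ⟨0, 0, by simp⟩
    · exact exists_sq_sub_mul_sq_of_pow_odd hb hodd (exists_sq_sub_mul_sq_pow_finrank h)
  · rintro ⟨x, y, rfl⟩
    exact ⟨algebraMap F K x, algebraMap F K y, by simp⟩

/-! ### Legendre's theorem on ternary quadratic equations -/

/-- `X` is the ceiling of `√n`; the shift to `n - 1` keeps `t ^ 2 < n` strict when `n` is a perfect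
square. -/
theorem Nat.exists_le_sq_forall_lt {n : ℕ} (hn : 0 < n) :
    ∃ X : ℕ, n ≤ X ^ 2 ∧ ∀ t < X, t ^ 2 < n := by
  refine ⟨Nat.sqrt (n - 1) + 1, ?_, fun t ht => ?_⟩
  · have := Nat.sqrt_lt' (m := n - 1) (n := Nat.sqrt (n - 1) + 1)
    have := this.1 (Nat.lt_succ_self _)
    omega
  · have := Nat.le_sqrt'.1 (Nat.le_of_lt_succ ht)
    omega

/-- A box with more than `a * b * c` points contains two points with the same image. -/
theorem exists_small_solution_modEq {a b c : ℕ} (ha : 0 < a) (hb : 0 < b) (hc : 0 < c) (u v w : ℤ)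
    {X Y Z : ℕ} (h : a * b * c < X * Y * Z) :
    ∃ x y z : ℤ, ¬ (x = 0 ∧ y = 0 ∧ z = 0) ∧ x.natAbs < X ∧ y.natAbs < Y ∧ z.natAbs < Z ∧
      (a : ℤ) ∣ b * y - v * z ∧ (b : ℤ) ∣ c * z - w * x ∧ (c : ℤ) ∣ a * x - u * y := by
  have : NeZero a := ⟨ha.ne'⟩
  have : NeZero b := ⟨hb.ne'⟩
  have : NeZero c := ⟨hc.ne'⟩
  let φ : Fin X × Fin Y × Fin Z → ZMod a × ZMod b × ZMod c := fun t =>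
    (((b * (t.2.1 : ℕ) - v * (t.2.2 : ℕ) : ℤ) : ZMod a),
      ((c * (t.2.2 : ℕ) - w * (t.1 : ℕ) : ℤ) : ZMod b),
      ((a * (t.1 : ℕ) - u * (t.2.1 : ℕ) : ℤ) : ZMod c))
  obtain ⟨⟨x, y, z⟩, ⟨x', y', z'⟩, hne, heq⟩ := Fintype.exists_ne_map_eq_of_card_lt φ (by
    simpa [ZMod.card, ← mul_assoc] using h)
  simp only [φ, Prod.mk.injEq, ZMod.intCast_eq_intCast_iff_dvd_sub] at heq
  obtain ⟨h1, h2, h3⟩ := heq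
  refine ⟨(x' : ℕ) - (x : ℕ), (y' : ℕ) - (y : ℕ), (z' : ℕ) - (z : ℕ), ?_, by omega, by omega,
    by omega, ?_, ?_, ?_⟩
  · rintro ⟨hx, hy, hz⟩
    apply hne
    ext <;> simp <;> omega
  · convert h1 using 1; ring
  · convert h2 using 1; ring
  · convert h3 using 1; ring

theorem Nat.eq_one_of_squarefree_mul_sq {a b X : ℕ} (ha : Squarefree a) (hb : Squarefree b)
    (hab : a.Coprime b) (h : a * b = X ^ 2) : a = 1 ∧ b = 1 := by
  have hs : Squarefree (a * b) := (Nat.squarefree_mul hab).2 ⟨ha, hb⟩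
  have hX : IsUnit X := hs X (by rw [h, pow_two])
  rw [Nat.isUnit_iff] at hX
  subst hX
  exact mul_eq_one.1 (by simpa using h)

/-- **Legendre's theorem** on the equation `a * x ^ 2 + b * y ^ 2 = c * z ^ 2`. -/
theorem legendre_ternary {a b c : ℕ} (ha : Squarefree a) (hb : Squarefree b) (hc : Squarefree c)
    (hab : a.Coprime b) (hbc : b.Coprime c) (hac : a.Coprime c) {u v w : ℤ}
    (hu : (c : ℤ) ∣ u ^ 2 + a * b) (hv : (a : ℤ) ∣ v ^ 2 - b * c) (hw : (b : ℤ) ∣ w ^ 2 - a * c) :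
    ∃ x y z : ℤ, ¬ (x = 0 ∧ y = 0 ∧ z = 0) ∧ a * x ^ 2 + b * y ^ 2 = c * z ^ 2 := by
  have ha0 : 0 < a := Nat.pos_of_ne_zero ha.ne_zero
  have hb0 : 0 < b := Nat.pos_of_ne_zero hb.ne_zero
  have hc0 : 0 < c := Nat.pos_of_ne_zero hc.ne_zero
  by_cases htriv : a = 1 ∧ b = 1 ∧ c = 1
  · obtain ⟨rfl, rfl, rfl⟩ := htriv
    exact ⟨1, 0, 1, by simp, by simp⟩
  obtain ⟨X, hX, hX'⟩ := Nat.exists_le_sq_forall_lt (Nat.mul_pos hb0 hc0)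
  obtain ⟨Y, hY, hY'⟩ := Nat.exists_le_sq_forall_lt (Nat.mul_pos ha0 hc0)
  obtain ⟨Z, hZ, hZ'⟩ := Nat.exists_le_sq_forall_lt (Nat.mul_pos ha0 hb0)
  -- Strictness can fail only if `b * c` and `a * c` are both squares, which for squarefree coprime
  -- factors forces `a = b = c = 1`.
  have hlt : a * b * c < X * Y * Z := by
    have key : (a * b * c) ^ 2 < (X * Y * Z) ^ 2 := by
      have e : (a * b * c) ^ 2 = (b * c) * (a * c) * (a * b) := by ring
      rw [e, mul_pow, mul_pow]
      have hbc0 := Nat.mul_pos hb0 hc0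
      have hac0 := Nat.mul_pos ha0 hc0
      have hab0 := Nat.mul_pos ha0 hb0
      rcases hX.lt_or_eq with hX1 | hX1
      · exact Nat.mul_lt_mul_of_lt_of_le (Nat.mul_lt_mul_of_lt_of_le hX1 hY (hac0.trans_le hY)) hZ (hab0.trans_le hZ)
      · rcases hY.lt_or_eq with hY1 | hY1
        · exact Nat.mul_lt_mul_of_lt_of_le (Nat.mul_lt_mul_of_le_of_lt hX hY1 (hbc0.trans_le hX)) hZ (hab0.trans_le hZ)
        · obtain ⟨h1, h2⟩ := Nat.eq_one_of_squarefree_mul_sq hb hc hbc hX1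
          obtain ⟨h3, -⟩ := Nat.eq_one_of_squarefree_mul_sq ha hc hac hY1
          exact absurd ⟨h3, h1, h2⟩ htriv
    exact lt_of_pow_lt_pow_left₀ 2 (Nat.zero_le _) key
  obtain ⟨x, y, z, hne, hx, hy, hz, h1, h2, h3⟩ :=
    exists_small_solution_modEq ha0 hb0 hc0 u v w hlt
  have hx2 : x ^ 2 < b * c := by
    rw [← Int.natAbs_sq]; exact_mod_cast hX' _ hx
  have hy2 : y ^ 2 < a * c := by
    rw [← Int.natAbs_sq]; exact_mod_cast hY' _ hy
  have hz2 : z ^ 2 < a * b := by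
    rw [← Int.natAbs_sq]; exact_mod_cast hZ' _ hz
  have iab : IsCoprime (a : ℤ) b := Nat.isCoprime_iff_coprime.2 hab
  have ibc : IsCoprime (b : ℤ) c := Nat.isCoprime_iff_coprime.2 hbc
  have iac : IsCoprime (a : ℤ) c := Nat.isCoprime_iff_coprime.2 hac
  -- Modulo `a`, `b` times the form is `(b * y) ^ 2 - (v * z) ^ 2`, which has the factor `b * y - v
  -- * z`. The other two moduli are alike.
  have da : (a : ℤ) ∣ a * x ^ 2 + b * y ^ 2 - c * z ^ 2 := by
    apply iab.dvd_of_dvd_mul_left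
    obtain ⟨r, hr⟩ := h1
    obtain ⟨s, hs⟩ := hv
    exact ⟨b * x ^ 2 + r * (b * y + v * z) + s * z ^ 2, by
      linear_combination (b * y + v * z) * hr + z ^ 2 * hs⟩
  have db : (b : ℤ) ∣ a * x ^ 2 + b * y ^ 2 - c * z ^ 2 := by
    apply ibc.dvd_of_dvd_mul_left
    obtain ⟨r, hr⟩ := h2
    obtain ⟨s, hs⟩ := hw
    exact ⟨c * y ^ 2 - r * (c * z + w * x) - s * x ^ 2, by
      linear_combination -(c * z + w * x) * hr - x ^ 2 * hs⟩
  have dc : (c : ℤ) ∣ a * x ^ 2 + b * y ^ 2 - c * z ^ 2 := by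
    apply iac.symm.dvd_of_dvd_mul_left
    obtain ⟨r, hr⟩ := h3
    obtain ⟨s, hs⟩ := hu
    exact ⟨-a * z ^ 2 + r * (a * x + u * y) + s * y ^ 2, by
      linear_combination (a * x + u * y) * hr + y ^ 2 * hs⟩
  obtain ⟨k, hk⟩ : (a * b * c : ℤ) ∣ a * x ^ 2 + b * y ^ 2 - c * z ^ 2 :=
    (iac.mul_left ibc).mul_dvd (iab.mul_dvd da db) dc
  have haZ : (0 : ℤ) < a := by exact_mod_cast ha0
  have hbZ : (0 : ℤ) < b := by exact_mod_cast hb0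
  have hcZ : (0 : ℤ) < c := by exact_mod_cast hc0
  have habc : (0 : ℤ) < a * b * c := by positivity
  have e1 : a * x ^ 2 < a * b * c := by linarith [mul_lt_mul_of_pos_left hx2 haZ]
  have e2 : b * y ^ 2 < a * b * c := by linarith [mul_lt_mul_of_pos_left hy2 hbZ]
  have e3 : c * z ^ 2 < a * b * c := by linarith [mul_lt_mul_of_pos_left hz2 hcZ]
  have e4 : 0 ≤ a * x ^ 2 := by positivity
  have e5 : 0 ≤ b * y ^ 2 := by positivity
  have e6 : 0 ≤ c * z ^ 2 := by positivity
  -- The size bounds place the form strictly between `-abc` and `2abc`.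
  have hk1 : -1 < k := by
    by_contra! hcon
    linarith [mul_le_mul_of_nonneg_left hcon habc.le]
  have hk2 : k < 2 := by
    by_contra! hcon
    linarith [mul_le_mul_of_nonneg_left hcon habc.le]
  obtain rfl | rfl : k = 0 ∨ k = 1 := by omega
  · exact ⟨x, y, z, hne, by linear_combination hk⟩
  -- Here `a * x ^ 2 + b * y ^ 2 = c * (z ^ 2 + a * b)`; multiplying by `z ^ 2 + a * b` and
  -- composing the forms on the left makes the right side `c` times a square.
  · refine ⟨x * z - b * y, a * x + y * z, z ^ 2 + a * b, ?_, ?_⟩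
    · rintro ⟨-, -, h0⟩
      nlinarith [sq_nonneg z, mul_pos haZ hbZ]
    · linear_combination (z ^ 2 + a * b) * hk

/-- **Legendre's theorem** with a middle coefficient of arbitrary sign. -/
theorem legendre_ternary_int {a c : ℕ} {b : ℤ} (ha : Squarefree a) (hb : Squarefree b)
    (hc : Squarefree c) (hab : a.Coprime b.natAbs) (hbc : b.natAbs.Coprime c) (hac : a.Coprime c)
    {u v w : ℤ} (hu : (c : ℤ) ∣ u ^ 2 + a * b) (hv : (a : ℤ) ∣ v ^ 2 - b * c)
    (hw : b ∣ w ^ 2 - a * c) :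
    ∃ x y z : ℤ, ¬ (x = 0 ∧ y = 0 ∧ z = 0) ∧ a * x ^ 2 + b * y ^ 2 = c * z ^ 2 := by
  have hb' : Squarefree b.natAbs := Int.squarefree_natAbs.2 hb
  obtain ⟨n, rfl | rfl⟩ := b.eq_nat_or_neg
  · exact legendre_ternary ha hb' hc hab hbc hac hu hv hw
  · simp only [Int.natAbs_neg, Int.natAbs_natCast] at hb' hab hbc
    obtain ⟨x, y, z, hne, h⟩ := legendre_ternary hb' hc ha hbc hac.symm hab.symm
      (u := v) (v := w) (w := u) (by convert hv using 1; ring)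
      (by rw [← Int.neg_dvd]; convert hw using 1; ring) (by convert hu using 1; ring)
    exact ⟨z, x, y, by tauto, by linear_combination -h⟩

/-! ### Residues and primes with prescribed quadratic characters -/

theorem exists_dvd_sq_sub_mul {a b : ℕ} (hab : a.Coprime b) {k : ℤ}
    (ha : ∃ u : ℤ, (a : ℤ) ∣ u ^ 2 - k) (hb : ∃ u : ℤ, (b : ℤ) ∣ u ^ 2 - k) :
    ∃ u : ℤ, ((a * b : ℕ) : ℤ) ∣ u ^ 2 - k := by
  obtain ⟨u, r, hr⟩ := ha
  obtain ⟨v, t, ht⟩ := hb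
  have hco : IsCoprime (a : ℤ) b := Nat.isCoprime_iff_coprime.2 hab
  obtain ⟨m, n, hmn⟩ := id hco
  refine ⟨u * n * b + v * m * a, ?_⟩
  push_cast
  refine hco.mul_dvd ⟨(v - u) * m * (u * n * b + v * m * a + u) + r, ?_⟩
    ⟨(u - v) * n * (u * n * b + v * m * a + v) + t, ?_⟩
  · linear_combination hr + u * (u * n * b + v * m * a + u) * hmn
  · linear_combination ht + v * (u * n * b + v * m * a + v) * hmn

theorem exists_dvd_sq_sub_two (k : ℤ) : ∃ u : ℤ, ((2 : ℕ) : ℤ) ∣ u ^ 2 - k :=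
  ⟨k, by
    obtain ⟨t, ht⟩ := Int.even_mul_pred_self k
    exact ⟨t, by push_cast; linear_combination ht⟩⟩

theorem exists_dvd_sq_sub_of_jacobiSym {p : ℕ} [Fact p.Prime] {k : ℤ} (h : jacobiSym k p = 1) :
    ∃ u : ℤ, (p : ℤ) ∣ u ^ 2 - k := by
  obtain ⟨c, hc⟩ := ZMod.isSquare_of_jacobiSym_eq_one h
  obtain ⟨u, rfl⟩ := ZMod.intCast_surjective c
  refine ⟨u, (ZMod.intCast_zmod_eq_zero_iff_dvd _ _).1 ?_⟩
  push_cast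
  rw [hc]
  ring

theorem jacobiSym_congr {a b : ℤ} {n : ℕ} (h : (n : ℤ) ∣ a - b) : jacobiSym a n = jacobiSym b n :=
  jacobiSym.mod_left' (Int.modEq_iff_dvd.2 h).symm

theorem exists_dvd_sub_dvd_sub {a b : ℕ} (hab : a.Coprime b) (u v : ℤ) :
    ∃ k : ℤ, (a : ℤ) ∣ k - u ∧ (b : ℤ) ∣ k - v := by
  obtain ⟨m, n, hmn⟩ := Nat.isCoprime_iff_coprime.2 hab
  exact ⟨u * n * b + v * m * a, ⟨(v - u) * m, by linear_combination u * hmn⟩,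
    ⟨(u - v) * n, by linear_combination v * hmn⟩⟩

theorem isCoprime_of_dvd_sub {k u n : ℤ} (h : n ∣ k - u) (hu : IsCoprime u n) : IsCoprime k n := by
  obtain ⟨t, ht⟩ := h
  rw [show k = u + n * t by linear_combination ht]
  exact IsCoprime.add_mul_left_left hu t

/-- A prime in a residue class modulo an odd number, with prescribed residue `1` or `5` modulo `8`,
and the quadratic characters that follow. -/
theorem exists_prime_jacobiSym (N : ℕ) {D : ℕ} (hD : Odd D) {k : ℤ} (hk : IsCoprime k D) {ε : ℤ}
    (hε : ε = 1 ∨ ε = -1) :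
    ∃ r : ℕ, N < r ∧ r.Prime ∧ r % 4 = 1 ∧ (D : ℤ) ∣ r - k ∧ jacobiSym 2 r = ε ∧
      jacobiSym D r = jacobiSym k D := by
  have hD0 : D ≠ 0 := by rintro rfl; simp at hD
  have h8 : Nat.Coprime 8 D := (Nat.Coprime.pow_left 3 (Nat.coprime_two_left.2 hD) : Nat.Coprime (2 ^ 3) D)
  obtain ⟨ρ, hρ⟩ : ∃ ρ : ℤ, (ε = 1 ∧ ρ = 1) ∨ (ε = -1 ∧ ρ = 5) := by
    rcases hε with h | h
    · exact ⟨1, Or.inl ⟨h, rfl⟩⟩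
    · exact ⟨5, Or.inr ⟨h, rfl⟩⟩
  obtain ⟨a, ha8, haD⟩ := exists_dvd_sub_dvd_sub h8 ρ k
  have hρ8 : IsCoprime ρ ((8 : ℕ) : ℤ) := by
    rcases hρ with ⟨-, rfl⟩ | ⟨-, rfl⟩
    · exact isCoprime_one_left
    · exact ⟨5, -3, by norm_num⟩
  have hco : IsCoprime a ((8 * D : ℕ) : ℤ) := by
    push_cast
    exact (isCoprime_of_dvd_sub ha8 hρ8).mul_right (isCoprime_of_dvd_sub haD hk)
  obtain ⟨r, hrN, hr, hra⟩ := Nat.forall_exists_prime_gt_and_zmodEq N (by positivity) hco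
  have hra' : ((8 * D : ℕ) : ℤ) ∣ r - a := hra.symm.dvd
  push_cast at hra'
  have hr8 : (8 : ℤ) ∣ r - ρ := by
    simpa using dvd_add ((Dvd.intro _ rfl).trans hra') ha8
  have hrD : (D : ℤ) ∣ r - k := by
    simpa using dvd_add ((Dvd.intro_left _ rfl).trans hra') haD
  have hr4 : r % 4 = 1 := by omega
  refine ⟨r, hrN, hr, hr4, hrD, ?_, ?_⟩
  · rw [jacobiSym.at_two (Nat.odd_iff.2 (by omega)), ZMod.χ₈_nat_eq_if_mod_eight]
    rcases hρ with ⟨rfl, rfl⟩ | ⟨rfl, rfl⟩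
    · have : r % 8 = 1 := by omega
      have : r % 2 = 1 := by omega
      simp [*]
    · have : r % 8 = 5 := by omega
      have : r % 2 = 1 := by omega
      simp [*]
  · rw [jacobiSym.quadratic_reciprocity_one_mod_four' hD hr4]
    exact jacobiSym_congr hrD

theorem Nat.Prime.coprime_of_lt_of_pos {r n : ℕ} (hr : r.Prime) (hn : 0 < n) (h : n < r) :
    n.Coprime r :=
  (hr.coprime_iff_not_dvd.2 fun hd => (Nat.le_of_dvd hn hd).not_gt h).symm

/-! ### Representing `p` times a sum of two squares -/

/-- Take `m = μ * r` with `r` a prime congruent to `k` modulo `g * D`, and apply Legendre's theorem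
to `g x² + d' y² = h μ r z²`. The congruences on `k` make `p * μ * r` and `d' * μ * r` squares
modulo `D` and `g`; reciprocity and `hμ` make `-d` a square modulo `r`. -/
theorem exists_mul_sum_two_squares_of_residues {d d' : ℤ} {p g h μ D : ℕ} {k : ℤ}
    (hd : Squarefree d) (hp : p.Prime) (hp2 : Odd p) (hgh : p = g * h) (hdd : d = g * d')
    (hh : ∃ u : ℤ, (h : ℤ) ∣ u ^ 2 - -d) (hhd : h.Coprime d'.natAbs) (hD : Odd D)
    (hμ : d'.natAbs = D ∧ (μ = 1 ∨ μ = 2) ∧ jacobiSym k (g * D : ℕ) = 1 ∨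
      d'.natAbs = 2 * D ∧ μ = 1)
    (hk : IsCoprime k (g * D : ℕ)) (hk1 : (D : ℤ) ∣ k - p * μ) (hk2 : (g : ℤ) ∣ k - d' * μ) :
    ∃ m s t : ℤ, m = s ^ 2 + t ^ 2 ∧ 0 < m ∧ ∃ x y z : ℤ, ¬ (x = 0 ∧ y = 0 ∧ z = 0) ∧
      x ^ 2 + d * y ^ 2 = p * m * z ^ 2 := by
  have hgp : g ∣ p := Dvd.intro _ hgh.symm
  have hhp : h ∣ p := Dvd.intro_left _ hgh.symm
  have hg2 : Odd g := Odd.of_dvd_nat hp2 hgp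
  have hh2 : Odd h := Odd.of_dvd_nat hp2 hhp
  have hgh' : g.Coprime h := by
    rcases hp.eq_one_or_self_of_dvd g hgp with rfl | rfl
    · exact Nat.coprime_one_left h
    · have : h = 1 := by
        have := hp.pos
        nlinarith
      subst this
      exact Nat.coprime_one_right g
  have hsg : Squarefree g := hp.squarefree.squarefree_of_dvd hgp
  have hsh : Squarefree h := hp.squarefree.squarefree_of_dvd hhp
  have hsd' : Squarefree d' := hd.squarefree_of_dvd (Dvd.intro_left _ hdd.symm)
  have hnat : d.natAbs = g * d'.natAbs := by rw [hdd, Int.natAbs_mul, Int.natAbs_natCast]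
  have hgd : g.Coprime d'.natAbs :=
    Nat.coprime_of_squarefree_mul (hnat ▸ Int.squarefree_natAbs.2 hd)
  -- For even `d'`, the sign of `(2/r)` is free and is chosen to cancel `(k/gD)`.
  obtain ⟨ε, hε, hε'⟩ : ∃ ε : ℤ, (ε = 1 ∨ ε = -1) ∧
      (d'.natAbs = 2 * D → ε = jacobiSym k (g * D : ℕ)) :=
    ⟨jacobiSym k (g * D : ℕ), jacobiSym.eq_one_or_neg_one (Int.isCoprime_iff_gcd_eq_one.1 hk),
      fun _ => rfl⟩
  obtain ⟨r, hrN, hr, hr4, hrk, hr2, hrJ⟩ :=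
    -- The lower bound makes `r` coprime to `p` and `d`.
    exists_prime_jacobiSym (p * d.natAbs + 2) (hg2.mul hD) hk hε
  have : Fact r.Prime := ⟨hr⟩
  have hr2' : Odd r := Nat.odd_iff.2 (by omega)
  have hd0 : 0 < d.natAbs := Int.natAbs_pos.2 hd.ne_zero
  have hpr : p.Coprime r := hr.coprime_of_lt_of_pos hp.pos (by nlinarith)
  have hdr : d.natAbs.Coprime r := hr.coprime_of_lt_of_pos hd0 (by nlinarith [hp.pos])
  have hgr : g.Coprime r := hpr.coprime_dvd_left hgp
  have hhr : h.Coprime r := hpr.coprime_dvd_left hhp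
  have hd'r : d'.natAbs.Coprime r := hdr.coprime_dvd_left (Dvd.intro_left _ hnat.symm)
  have hμ12 : μ = 1 ∨ μ = 2 := by tauto
  have hμodd {n : ℕ} (hn : Odd n) : n.Coprime μ := by
    rcases hμ12 with rfl | rfl
    · exact Nat.coprime_one_right n
    · exact Nat.coprime_two_right.2 hn
  have hμd : d'.natAbs.Coprime μ := by
    rcases hμ with ⟨h1, -⟩ | ⟨-, rfl⟩
    · exact hμodd (h1 ▸ hD)
    · exact Nat.coprime_one_right _
  have hsμ : Squarefree μ := by
    rcases hμ12 with rfl | rfl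
    · exact squarefree_one
    · exact Nat.prime_two.squarefree
  have hJ : jacobiSym (-d) r = 1 := by
    have hm1 : jacobiSym (-1) r = 1 := by
      rw [jacobiSym.at_neg_one hr2', ZMod.χ₄_nat_one_mod_four hr4]
    have habs : jacobiSym (d.natAbs : ℤ) r = 1 := by
      rw [hnat]
      rcases hμ with ⟨h1, -, h3⟩ | ⟨h1, -⟩
      · rw [h1, hrJ, h3]
      · rw [h1, show ((g * (2 * D) : ℕ) : ℤ) = 2 * (g * D : ℕ) by push_cast; ring,
          jacobiSym.mul_left, hr2, hrJ, ← hε' h1]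
        rcases hε with h | h <;> simp [h]
    rcases Int.natAbs_eq d with h | h
    · rw [h, neg_eq_neg_one_mul, jacobiSym.mul_left, hm1, habs, one_mul]
    · rw [h, neg_neg, habs]
  have hμr : (μ * r : ℕ) ≠ 0 := by
    have := hr.pos
    rcases hμ12 with rfl | rfl <;> omega
  have hμany (c : ℤ) : ∃ u : ℤ, (μ : ℤ) ∣ u ^ 2 - c := by
    rcases hμ12 with rfl | rfl
    · exact ⟨0, by simp⟩
    · exact exists_dvd_sq_sub_two c
  obtain ⟨u, hu⟩ := exists_dvd_sq_sub_mul
    (Nat.Coprime.mul_right (hμodd hh2) hhr) hh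
    (exists_dvd_sq_sub_mul (hμodd hr2').symm (hμany (-d)) (exists_dvd_sq_sub_of_jacobiSym hJ))
  have hrD : (D : ℤ) ∣ r - p * μ := by
    have : (D : ℤ) ∣ r - k := (Dvd.intro_left _ (by push_cast; rfl)).trans hrk
    simpa using dvd_add this hk1
  have hrg : (g : ℤ) ∣ r - d' * μ := by
    have : (g : ℤ) ∣ r - k := (Dvd.intro _ (by push_cast; rfl)).trans hrk
    simpa using dvd_add this hk2
  obtain ⟨v, hv⟩ : ∃ v : ℤ, (g : ℤ) ∣ v ^ 2 - d' * (h * (μ * r) : ℕ) := by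
    rcases hp.eq_one_or_self_of_dvd g hgp with h1 | h1
    · exact ⟨0, by simp [h1]⟩
    · have : h = 1 := by
        have := hp.pos
        rw [h1] at hgh
        nlinarith
      obtain ⟨t, ht⟩ := hrg
      refine ⟨d' * μ, -(d' * μ) * t, ?_⟩
      rw [this]
      push_cast
      linear_combination -(d' * μ) * ht
  obtain ⟨w, hw⟩ : ∃ w : ℤ, d' ∣ w ^ 2 - g * (h * (μ * r) : ℕ) := by
    have hgm : (g : ℤ) * (h * (μ * r) : ℕ) = p * μ * r := by
      rw [hgh]; push_cast; ring
    rw [hgm]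
    have hDsq : ∃ w : ℤ, (D : ℤ) ∣ w ^ 2 - p * μ * r := by
      obtain ⟨t, ht⟩ := hrD
      exact ⟨p * μ, -(p * μ) * t, by linear_combination -(p * μ : ℤ) * ht⟩
    have : ∃ w : ℤ, (d'.natAbs : ℤ) ∣ w ^ 2 - p * μ * r := by
      rcases hμ with ⟨h1, -⟩ | ⟨h1, -⟩
      · rwa [h1]
      · rw [h1]
        exact exists_dvd_sq_sub_mul (Nat.coprime_two_left.2 hD) (exists_dvd_sq_sub_two _) hDsq
    simpa only [Int.natAbs_dvd] using this
  obtain ⟨x, y, z, hne, hxyz⟩ := legendre_ternary_int (a := g) (b := d') (c := h * (μ * r))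
    hsg hsd' ((Nat.squarefree_mul (Nat.Coprime.mul_right (hμodd hh2) hhr)).2
      ⟨hsh, (Nat.squarefree_mul (hμodd hr2').symm).2 ⟨hsμ, hr.squarefree⟩⟩) hgd
    (Nat.Coprime.mul_right hhd.symm (Nat.Coprime.mul_right hμd hd'r))
    (Nat.Coprime.mul_right hgh' (Nat.Coprime.mul_right (hμodd hg2) hgr))
    (u := u) (by rw [← hdd]; simpa using hu) hv hw
  obtain ⟨s, t, hst⟩ : ∃ s t : ℤ, ((μ * r : ℕ) : ℤ) = s ^ 2 + t ^ 2 := by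
    obtain ⟨s, t, hst⟩ := Nat.Prime.sq_add_sq (p := r) (by omega)
    rcases hμ12 with rfl | rfl
    · exact ⟨s, t, by rw [one_mul, ← hst]; push_cast; ring⟩
    · exact ⟨s + t, s - t, by rw [← hst]; push_cast; ring⟩
  refine ⟨(μ * r : ℕ), s, t, hst, by exact_mod_cast Nat.pos_of_ne_zero hμr, g * x, y, z, ?_, ?_⟩
  · rintro ⟨h1, h2⟩
    have : (g : ℤ) ≠ 0 := by exact_mod_cast hsg.ne_zero
    exact hne ⟨(mul_eq_zero.1 h1).resolve_left this, h2⟩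
  · rw [hdd, hgh]
    push_cast at hxyz ⊢
    linear_combination (g : ℤ) * hxyz

/-- For negative `e`, the sign from `(-1/p) = -1` cancels the sign from reciprocity. -/
theorem jacobiSym_natAbs_of_one_mod_four {p : ℕ} (hp : p % 4 = 3) {e : ℤ} (he : e % 4 = 1) :
    jacobiSym p e.natAbs = jacobiSym e p := by
  have hp2 : Odd p := Nat.odd_iff.2 (by omega)
  obtain ⟨n, rfl | rfl⟩ := e.eq_nat_or_neg
  · rw [Int.natAbs_natCast]
    exact jacobiSym.quadratic_reciprocity_one_mod_four' hp2 (by omega)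
  · rw [Int.natAbs_neg, Int.natAbs_natCast, jacobiSym.neg _ hp2, ZMod.χ₄_nat_three_mod_four hp,
      jacobiSym.quadratic_reciprocity_three_mod_four hp (by omega), neg_one_mul]

theorem jacobiSym_natAbs_of_three_mod_four {p : ℕ} (hp : p % 4 = 3) {e : ℤ} (he : e % 4 = 3) :
    jacobiSym p e.natAbs = -jacobiSym e p := by
  have hp2 : Odd p := Nat.odd_iff.2 (by omega)
  obtain ⟨n, rfl | rfl⟩ := e.eq_nat_or_neg
  · rw [Int.natAbs_natCast]
    exact jacobiSym.quadratic_reciprocity_three_mod_four hp (by omega)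
  · rw [Int.natAbs_neg, Int.natAbs_natCast, jacobiSym.neg _ hp2, ZMod.χ₄_nat_three_mod_four hp,
      jacobiSym.quadratic_reciprocity_one_mod_four' hp2 (by omega), neg_one_mul, neg_neg]

theorem jacobiSym_two_natAbs {e : ℤ} (he : e % 8 = 5) : jacobiSym 2 e.natAbs = -1 := by
  have h : e.natAbs % 8 = 5 ∨ e.natAbs % 8 = 3 := by omega
  have h2 : e.natAbs % 2 ≠ 0 := by omega
  rw [jacobiSym.at_two (Nat.odd_iff.2 (by omega)), ZMod.χ₈_nat_eq_if_mod_eight]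
  rcases h with h | h <;> simp [h2, h]

theorem Int.emod_four_ne_zero_of_squarefree {d : ℤ} (hd : Squarefree d) : d % 4 ≠ 0 := by
  intro h
  obtain ⟨t, ht⟩ := Int.dvd_of_emod_eq_zero h
  have := Int.isUnit_iff.1 (hd 2 ⟨t, by rw [ht]; ring⟩)
  omega

/-- If `d` is not `1` modulo `8` and the residue conditions at a prime `p = g * h` hold, some
`p * m` with `m > 0` a sum of two squares is represented by `x ^ 2 + d * y ^ 2` over `ℚ`. -/
theorem exists_mul_sum_two_squares_of_dvd {d d' : ℤ} {p g h : ℕ}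
    (hd : Squarefree d) (hp : p.Prime) (hp4 : p % 4 = 3) (hgh : p = g * h) (hdd : d = g * d')
    (hh : ∃ u : ℤ, (h : ℤ) ∣ u ^ 2 - -d) (hpd : p.Coprime d'.natAbs) (hd8 : d % 8 ≠ 1)
    (hJ3 : d % 4 = 3 → jacobiSym d' g * jacobiSym p d'.natAbs = 1)
    (hJ5 : d % 8 = 5 → jacobiSym d' g * jacobiSym p d'.natAbs = -1) :
    ∃ m s t : ℤ, m = s ^ 2 + t ^ 2 ∧ 0 < m ∧ ∃ x y z : ℤ, ¬ (x = 0 ∧ y = 0 ∧ z = 0) ∧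
      x ^ 2 + d * y ^ 2 = p * m * z ^ 2 := by
  have hp2 : Odd p := Nat.odd_iff.2 (by omega)
  have hd4 := Int.emod_four_ne_zero_of_squarefree hd
  have hd'0 : d'.natAbs ≠ 0 := by
    rw [Int.natAbs_ne_zero]; rintro rfl; simp [hdd] at hd4
  have hgp : g ∣ p := Dvd.intro _ hgh.symm
  have hg2 : Odd g := Odd.of_dvd_nat hp2 hgp
  have hgd : g.Coprime d'.natAbs := hpd.coprime_dvd_left hgp
  have hhd : h.Coprime d'.natAbs := hpd.coprime_dvd_left (Dvd.intro_left _ hgh.symm)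
  have hnat : d.natAbs = g * d'.natAbs := by rw [hdd, Int.natAbs_mul, Int.natAbs_natCast]
  have hg0 : g ≠ 0 := by rintro rfl; simp at hg2
  -- `D` is the odd part of `d'`. For odd `d`, `μ` must correct the sign of `(d'/g)(p/D)`: `1`
  -- suffices if `d ≡ 3` modulo `4`, and `2` works if `d ≡ 5` modulo `8` because `(2/|d|) = -1`.
  obtain ⟨D, μ, hD, hμ12, hcase⟩ : ∃ D μ : ℕ, Odd D ∧ (μ = 1 ∨ μ = 2) ∧
      (d'.natAbs = D ∧ jacobiSym μ (g * D : ℕ) = jacobiSym d' g * jacobiSym p D ∨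
        d'.natAbs = 2 * D ∧ μ = 1) := by
    rcases Nat.even_or_odd d'.natAbs with he | ho
    · obtain ⟨D, hD⟩ := he.two_dvd
      refine ⟨D, 1, ?_, Or.inl rfl, Or.inr ⟨hD, rfl⟩⟩
      by_contra hDe
      obtain ⟨E, rfl⟩ := (Nat.not_odd_iff_even.1 hDe).two_dvd
      have : (4 : ℕ) ∣ d.natAbs := ⟨g * E, by rw [hnat, hD]; ring⟩
      omega
    · have hdo : Odd d.natAbs := hnat ▸ hg2.mul ho
      have : d % 4 = 3 ∨ d % 8 = 5 := by
        rw [Nat.odd_iff] at hdo; omega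
      rcases this with h3 | h5
      · exact ⟨_, 1, ho, Or.inl rfl, Or.inl ⟨rfl, by
          rw [hJ3 h3, Nat.cast_one, jacobiSym.one_left]⟩⟩
      · exact ⟨_, 2, ho, Or.inr rfl, Or.inl ⟨rfl, by
          rw [hJ5 h5, ← hnat]; exact jacobiSym_two_natAbs h5⟩⟩
  have hDd : D ∣ d'.natAbs := by
    rcases hcase with ⟨h1, -⟩ | ⟨h1, -⟩ <;> simp [h1]
  have hD0 : D ≠ 0 := by rintro rfl; simp at hD
  have hμodd {n : ℕ} (hn : Odd n) : IsCoprime (μ : ℤ) n := by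
    rw [Nat.isCoprime_iff_coprime]
    rcases hμ12 with rfl | rfl
    · exact Nat.coprime_one_left n
    · exact Nat.coprime_two_left.2 hn
  obtain ⟨k, hk1, hk2⟩ :=
    exists_dvd_sub_dvd_sub (hgd.symm.coprime_dvd_left hDd) (p * μ : ℤ) (d' * μ)
  have hkD : IsCoprime k (D : ℤ) := isCoprime_of_dvd_sub hk1
    ((Nat.isCoprime_iff_coprime.2 (hpd.coprime_dvd_right hDd)).mul_left (hμodd hD))
  have hkg : IsCoprime k (g : ℤ) := isCoprime_of_dvd_sub hk2
    (IsCoprime.mul_left (by rw [Int.isCoprime_iff_gcd_eq_one]; exact hgd.symm) (hμodd hg2))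
  refine exists_mul_sum_two_squares_of_residues hd hp hp2 hgh hdd hh hhd hD ?_
    (by push_cast; exact hkg.mul_right hkD) hk1 hk2
  rcases hcase with ⟨h1, h2⟩ | h1
  · refine Or.inl ⟨h1, hμ12, ?_⟩
    rw [jacobiSym.mul_right' _ hg0 hD0, jacobiSym_congr hk1, jacobiSym_congr hk2,
      jacobiSym.mul_left, jacobiSym.mul_left]
    rw [jacobiSym.mul_right' _ hg0 hD0] at h2
    have hg1 := jacobiSym.sq_one (Int.isCoprime_iff_gcd_eq_one.1 (hμodd hg2))
    have hD1 := jacobiSym.sq_one (Int.isCoprime_iff_gcd_eq_one.1 (hμodd hD))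
    calc _ = (jacobiSym d' g * jacobiSym p D) * (jacobiSym μ g * jacobiSym μ D) := by ring
      _ = jacobiSym μ g ^ 2 * jacobiSym μ D ^ 2 := by rw [← h2]; ring
      _ = 1 := by rw [hg1, hD1, one_mul]
  · exact Or.inr h1

/-- The split `p = g * h` has `g = p` if `p` divides `d`, and `g = 1` otherwise. -/
theorem exists_mul_sum_two_squares {d : ℤ} (hd : Squarefree d) {p : ℕ} [Fact p.Prime]
    (hp4 : p % 4 = 3) (hdp : jacobiSym d p ≠ 1) (hd8 : d % 8 ≠ 1) :
    ∃ m s t : ℤ, m = s ^ 2 + t ^ 2 ∧ 0 < m ∧ ∃ x y z : ℤ, ¬ (x = 0 ∧ y = 0 ∧ z = 0) ∧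
      x ^ 2 + d * y ^ 2 = p * m * z ^ 2 := by
  have hp : p.Prime := Fact.out
  have hp2 : Odd p := Nat.odd_iff.2 (by omega)
  by_cases hpd : (p : ℤ) ∣ d
  · obtain ⟨d', rfl⟩ := hpd
    have hco : p.Coprime d'.natAbs := by
      apply Nat.coprime_of_squarefree_mul
      simpa [Int.natAbs_mul] using Int.squarefree_natAbs.2 hd
    have hsq : jacobiSym d' p ^ 2 = 1 := jacobiSym.sq_one hco.symm
    have hpd4 : ((p : ℤ) * d') % 4 = (3 * d') % 4 := by
      rw [Int.mul_emod, show (p : ℤ) % 4 = 3 by omega]; omega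
    refine exists_mul_sum_two_squares_of_dvd (g := p) (h := 1) hd hp hp4 (mul_one p).symm rfl
      ⟨0, by simp⟩ hco hd8 (fun h3 => ?_) (fun h5 => ?_)
    · rw [jacobiSym_natAbs_of_one_mod_four hp4 (by omega), ← pow_two, hsq]
    · rw [jacobiSym_natAbs_of_three_mod_four hp4 (by omega), mul_neg, ← pow_two, hsq]
  · have hco : p.Coprime d.natAbs := by
      rw [hp.coprime_iff_not_dvd]
      rwa [← Int.natCast_dvd]
    have hJ : jacobiSym d p = -1 :=
      (jacobiSym.eq_one_or_neg_one hco.symm).resolve_left hdp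
    refine exists_mul_sum_two_squares_of_dvd (g := 1) (h := p) hd hp hp4 (one_mul p).symm
      (by simp) (exists_dvd_sq_sub_of_jacobiSym ?_) hco hd8 (fun h3 => ?_) (fun h5 => ?_)
    · rw [jacobiSym.neg _ hp2, ZMod.χ₄_nat_three_mod_four hp4, hJ]; rfl
    · rw [jacobiSym_natAbs_of_three_mod_four hp4 h3, hJ, jacobiSym.one_right]; rfl
    · rw [jacobiSym_natAbs_of_one_mod_four hp4 (by omega), hJ, jacobiSym.one_right]; rfl

/-! ### Local square roots and local obstructions -/

theorem PadicInt.exists_sq_eq_intCast {p : ℕ} [Fact p.Prime] {d a : ℤ}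
    (h : ‖((a ^ 2 - d : ℤ) : ℤ_[p])‖ < ‖((2 * a : ℤ) : ℤ_[p])‖ ^ 2) : ∃ s : ℤ_[p], s ^ 2 = d := by
  obtain ⟨s, hs, -⟩ := hensels_lemma (F := (Polynomial.X ^ 2 - Polynomial.C d : Polynomial ℤ))
    (a := (a : ℤ_[p])) (by
      have h2 : Polynomial.aeval (a : ℤ_[p]) (2 : Polynomial ℤ) = 2 := map_ofNat _ 2
      simpa [h2] using h)
  exact ⟨s, by simpa [sub_eq_zero] using hs⟩

theorem Padic.exists_sq_eq_of_legendreSym {p : ℕ} [Fact p.Prime] (hp : p ≠ 2) {d : ℤ}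
    (hd : legendreSym p d = 1) : ∃ s : ℚ_[p], s ^ 2 = d := by
  rw [jacobiSym.legendreSym.to_jacobiSym] at hd
  obtain ⟨a, ha⟩ := exists_dvd_sq_sub_of_jacobiSym hd
  have hpp : p.Prime := Fact.out
  have hna : ¬ (p : ℤ) ∣ 2 * a := by
    intro hdvd
    have hp' : Prime (p : ℤ) := Nat.prime_iff_prime_int.1 hpp
    have h2 : ¬ (p : ℤ) ∣ 2 := fun h2 =>
      hp ((Nat.prime_dvd_prime_iff_eq hpp Nat.prime_two).1 (by exact_mod_cast h2))
    have hpa : (p : ℤ) ∣ a := (hp'.dvd_or_dvd hdvd).resolve_left h2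
    have hpd : (p : ℤ) ∣ d := by
      simpa using dvd_sub (dvd_pow hpa two_ne_zero) ha
    rw [jacobiSym_congr (b := 0) (by simpa using hpd), jacobiSym.zero_left hpp.one_lt] at hd
    exact zero_ne_one hd
  have h1 : ‖((2 * a : ℤ) : ℤ_[p])‖ = 1 := by
    refine le_antisymm (PadicInt.norm_le_one _) (not_lt.1 fun h => hna ?_)
    exact (PadicInt.norm_int_lt_one_iff_dvd _).1 h
  obtain ⟨s, hs⟩ := PadicInt.exists_sq_eq_intCast (p := p) (d := d) (a := a) (by
    rw [h1, one_pow]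
    exact (PadicInt.norm_int_lt_one_iff_dvd _).2 ha)
  exact ⟨s, by exact_mod_cast congrArg ((↑) : ℤ_[p] → ℚ_[p]) hs⟩

theorem Padic.exists_sq_eq_of_one_mod_eight {d : ℤ} (hd : d ≡ 1 [ZMOD 8]) :
    ∃ s : ℚ_[2], s ^ 2 = d := by
  -- Hensel at `a = 1`: the error is at most `1/8`, below `|2| ^ 2 = 1/4`.
  obtain ⟨s, hs⟩ := PadicInt.exists_sq_eq_intCast (p := 2) (d := d) (a := 1) (by
    have h1 : ‖((1 ^ 2 - d : ℤ) : ℤ_[2])‖ ≤ ((2 : ℕ) : ℝ) ^ (-(3 : ℕ) : ℤ) :=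
      PadicInt.norm_int_le_pow_iff_dvd.2 (by simpa using hd.dvd)
    have h2 : ‖((2 * 1 : ℤ) : ℤ_[2])‖ = 2⁻¹ := by
      simpa using PadicInt.norm_p (p := 2)
    rw [h2]
    refine h1.trans_lt ?_
    norm_num)
  exact ⟨s, by exact_mod_cast congrArg ((↑) : ℤ_[2] → ℚ_[2]) hs⟩

/-- A solution over `ℚ_[p]` gives a primitive solution of the homogeneous equation. -/
theorem Padic.exists_primitive_of_sq_sub_mul_sq {p : ℕ} [Fact p.Prime] {a b : ℤ_[p]} {x y : ℚ_[p]}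
    (h : x ^ 2 - a * y ^ 2 = b) :
    ∃ X Y Z : ℤ_[p], (IsUnit X ∨ IsUnit Y ∨ IsUnit Z) ∧ X ^ 2 - a * Y ^ 2 = b * Z ^ 2 := by
  have key (m : ℚ_[p]) (hm : m ≠ 0) (hx : ‖x‖ ≤ ‖m‖) (hy : ‖y‖ ≤ ‖m‖) (h1 : ‖(1 : ℚ_[p])‖ ≤ ‖m‖)
      (hm' : m = x ∨ m = y ∨ m = 1) : ∃ X Y Z : ℤ_[p], (IsUnit X ∨ IsUnit Y ∨ IsUnit Z) ∧
        X ^ 2 - a * Y ^ 2 = b * Z ^ 2 := by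
    have hm0 : 0 < ‖m‖ := norm_pos_iff.2 hm
    have hle {t : ℚ_[p]} (ht : ‖t‖ ≤ ‖m‖) : ‖t / m‖ ≤ 1 := by
      rw [norm_div]; exact div_le_one_of_le₀ ht hm0.le
    refine ⟨⟨x / m, hle hx⟩, ⟨y / m, hle hy⟩, ⟨1 / m, hle h1⟩, ?_, ?_⟩
    · have hu : ‖m / m‖ = 1 := by rw [norm_div, div_self hm0.ne']
      rcases hm' with rfl | rfl | rfl
      · exact Or.inl (PadicInt.isUnit_iff.2 hu)
      · exact Or.inr (Or.inl (PadicInt.isUnit_iff.2 hu))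
      · exact Or.inr (Or.inr (PadicInt.isUnit_iff.2 hu))
    · apply Subtype.coe_injective
      change (x / m) ^ 2 - (a : ℚ_[p]) * (y / m) ^ 2 = b * (1 / m) ^ 2
      rw [← h]
      field_simp
  by_cases h1 : ‖x‖ ≤ ‖(1 : ℚ_[p])‖ ∧ ‖y‖ ≤ ‖(1 : ℚ_[p])‖
  · exact key 1 one_ne_zero h1.1 h1.2 le_rfl (by simp)
  have hpos {t : ℚ_[p]} (ht : ‖(1 : ℚ_[p])‖ ≤ ‖t‖) : t ≠ 0 :=
    norm_pos_iff.1 ((norm_pos_iff.2 one_ne_zero).trans_le ht)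
  rcases le_total ‖x‖ ‖y‖ with hxy | hxy
  · have h2 : ‖(1 : ℚ_[p])‖ ≤ ‖y‖ := by
      by_contra! hlt
      exact h1 ⟨hxy.trans hlt.le, hlt.le⟩
    exact key y (hpos h2) hxy le_rfl h2 (by simp)
  · have h2 : ‖(1 : ℚ_[p])‖ ≤ ‖x‖ := by
      by_contra! hlt
      exact h1 ⟨hlt.le, hxy.trans hlt.le⟩
    exact key x (hpos h2) le_rfl hxy h2 (by simp)

/-- Modulo `p` a primitive solution gives `X² = q Z²` with `q` a nonresidue, so `p` divides `X` and
`Z`, and then `Y`. -/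
theorem Padic.sq_sub_prime_mul_sq_ne {p q : ℕ} [Fact p.Prime] (hq : legendreSym p q = -1)
    (x y : ℚ_[p]) : x ^ 2 - p * y ^ 2 ≠ q := by
  intro h
  obtain ⟨X, Y, Z, hu, hXYZ⟩ :=
    Padic.exists_primitive_of_sq_sub_mul_sq (a := (p : ℤ_[p])) (b := (q : ℤ_[p])) (by simpa using h)
  have hdvd (t : ℤ_[p]) : PadicInt.toZMod t = 0 ↔ (p : ℤ_[p]) ∣ t := by
    rw [← RingHom.mem_ker, PadicInt.ker_toZMod, PadicInt.maximalIdeal_eq_span_p,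
      Ideal.mem_span_singleton]
  have hmod := congrArg PadicInt.toZMod hXYZ
  simp only [map_sub, map_mul, map_pow, map_natCast, CharP.cast_eq_zero, zero_mul, sub_zero] at hmod
  have hZ : PadicInt.toZMod Z = 0 := by
    by_contra hZ
    refine (legendreSym.eq_neg_one_iff p).1 hq ⟨PadicInt.toZMod X / PadicInt.toZMod Z, ?_⟩
    push_cast
    field_simp
    exact hmod.symm
  have hX : PadicInt.toZMod X = 0 := by simpa [hZ] using hmod
  obtain ⟨X', hX'⟩ := (hdvd X).1 hX
  obtain ⟨Z', hZ'⟩ := (hdvd Z).1 hZ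
  have hp0 : (p : ℤ_[p]) ≠ 0 := by exact_mod_cast (Fact.out : p.Prime).ne_zero
  have hY2 : Y ^ 2 = p * (X' ^ 2 - q * Z' ^ 2) := by
    apply mul_left_cancel₀ hp0
    rw [hX', hZ'] at hXYZ
    linear_combination -hXYZ
  have hY : PadicInt.toZMod Y = 0 := by
    have := congrArg PadicInt.toZMod hY2
    simpa using this
  rcases hu with hu | hu | hu
  · exact (hu.map PadicInt.toZMod).ne_zero hX
  · exact (hu.map PadicInt.toZMod).ne_zero hY
  · exact (hu.map PadicInt.toZMod).ne_zero hZ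

theorem Padic.two_sq_sub_mul_sq_ne {a b : ℕ} (ha : a % 4 = 3) (hb : b % 4 = 3) (x y : ℚ_[2]) :
    x ^ 2 - a * y ^ 2 ≠ b := by
  intro h
  obtain ⟨X, Y, Z, hu, hXYZ⟩ :=
    Padic.exists_primitive_of_sq_sub_mul_sq (a := (a : ℤ_[2])) (b := (b : ℤ_[2])) (by simpa using h)
  let φ : ℤ_[2] →+* ZMod 4 := PadicInt.toZModPow 2
  have hcast {n : ℕ} (hn : n % 4 = 3) : (n : ZMod 4) = 3 := by
    exact (ZMod.natCast_eq_natCast_iff n 3 4).2 hn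
  have hmod := congrArg φ hXYZ
  simp only [map_sub, map_mul, map_pow, map_natCast, hcast ha, hcast hb] at hmod
  -- This reads `u² + v² + w² = 0` modulo `4`, so all three are even; `2 * u = 0` encodes evenness.
  have hall : ∀ u v w : ZMod 4, u ^ 2 - 3 * v ^ 2 = 3 * w ^ 2 → 2 * u = 0 ∧ 2 * v = 0 ∧ 2 * w = 0 := by
    decide
  obtain ⟨h1, h2, h3⟩ := hall _ _ _ hmod
  have h20 : (2 : ZMod 4) ≠ 0 := by decide
  rcases hu with hu | hu | hu
  · exact h20 ((hu.map φ).mul_left_eq_zero.1 h1)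
  · exact h20 ((hu.map φ).mul_left_eq_zero.1 h2)
  · exact h20 ((hu.map φ).mul_left_eq_zero.1 h3)

/-! ### The quadratic field and its discriminant -/

theorem Int.sq_ne_intCast_of_squarefree {d : ℤ} (hd : Squarefree d) (hd1 : d ≠ 1) (b : ℚ) :
    b ^ 2 ≠ d := by
  intro h
  obtain ⟨n, rfl⟩ : ∃ n : ℤ, (n : ℚ) = b := by
    have : IsIntegral ℤ b := IsIntegral.of_pow two_pos (h ▸ isIntegral_algebraMap (A := ℚ) (x := d))
    exact IsIntegrallyClosed.isIntegral_iff.1 this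
  have h' : n ^ 2 = d := by exact_mod_cast h
  have hn := Int.isUnit_iff.1 (hd n ⟨1, by rw [← h']; ring⟩)
  rcases hn with rfl | rfl <;> exact hd1 (by rw [← h']; norm_num)

theorem minpoly_of_sq_eq_intCast {F : Type*} [Field F] [CharZero F] {d : ℤ}
    (hd : Squarefree d) (hd1 : d ≠ 1) {δ : F} (hδ : δ ^ 2 = d) :
    minpoly ℚ δ = Polynomial.X ^ 2 - Polynomial.C (d : ℚ) := by
  symm
  refine minpoly.eq_of_irreducible_of_monic
    (X_pow_sub_C_irreducible_of_prime Nat.prime_two (Int.sq_ne_intCast_of_squarefree hd hd1)) ?_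
    (Polynomial.monic_X_pow_sub_C _ two_ne_zero)
  simp [hδ]

theorem exists_ringHom_of_sq_eq {F : Type*} [Field F] [NumberField F] {d : ℤ}
    (hd : Squarefree d) (hd1 : d ≠ 1) {δ : F} (hδ : δ ^ 2 = d)
    (htop : IntermediateField.adjoin ℚ {δ} = ⊤) {L : Type*} [Field L] [CharZero L] {s : L}
    (hs : s ^ 2 = d) : Nonempty (F →+* L) := by
  have hint : IsIntegral ℚ δ := Algebra.IsIntegral.isIntegral δ
  let e : F ≃ₐ[ℚ] IntermediateField.adjoin ℚ {δ} :=
    IntermediateField.topEquiv.symm.trans (IntermediateField.equivOfEq htop.symm)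
  let f : IntermediateField.adjoin ℚ {δ} →ₐ[ℚ] L :=
    (IntermediateField.adjoin.powerBasis hint).lift s (by
      rw [IntermediateField.adjoin.powerBasis_gen, IntermediateField.minpoly_gen,
        minpoly_of_sq_eq_intCast hd hd1 hδ]
      simp [hs])
  exact ⟨(f.comp e.toAlgHom).toRingHom⟩

/-- `4 * d` is the discriminant of the family `1, δ`, and `n` is the determinant of its coordinates
in an integral basis. -/
theorem exists_four_mul_eq_sq_mul_discr {F : Type*} [Field F] [NumberField F] {d : ℤ}
    (hd : Squarefree d) (hd1 : d ≠ 1) {δ : F} (hδ : δ ^ 2 = d)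
    (htop : IntermediateField.adjoin ℚ {δ} = ⊤) : ∃ n : ℤ, 4 * d = n ^ 2 * NumberField.discr F := by
  have hint : IsIntegral ℚ δ := Algebra.IsIntegral.isIntegral δ
  have hmin := minpoly_of_sq_eq_intCast hd hd1 hδ
  have hrank : Module.finrank ℚ F = 2 := by
    have := IntermediateField.adjoin.finrank hint
    rw [htop, IntermediateField.finrank_top', hmin] at this
    rw [this]
    exact Polynomial.natDegree_X_pow_sub_C
  have hδint : IsIntegral ℤ δ :=
    IsIntegral.of_pow two_pos (hδ ▸ isIntegral_algebraMap (A := F) (x := d))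
  let D : 𝓞 F := ⟨δ, hδint⟩
  have hD : D * D = ((d : ℤ) : 𝓞 F) := by
    apply NumberField.RingOfIntegers.coe_injective
    rw [map_mul, map_intCast, ← hδ, pow_two]
    rfl
  have htr (k : ℤ) : Algebra.trace ℤ (𝓞 F) (k : 𝓞 F) = 2 * k := by
    have := Algebra.trace_algebraMap (S := 𝓞 F) k
    rw [NumberField.RingOfIntegers.rank, hrank] at this
    simpa using this
  have htrD : Algebra.trace ℤ (𝓞 F) D = 0 := by
    have h1 : Algebra.trace ℚ F δ = 0 := by
      have hdeg : (Polynomial.X ^ 2 - Polynomial.C (d : ℚ)).natDegree = 2 :=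
        Polynomial.natDegree_X_pow_sub_C
      rw [trace_eq_finrank_mul_minpoly_nextCoeff, hmin, Polynomial.nextCoeff, hdeg,
        Polynomial.coeff_sub, Polynomial.coeff_X_pow, Polynomial.coeff_C]
      simp
    have h2 := Algebra.coe_trace_int D
    rw [show (D : F) = δ from rfl, h1] at h2
    exact_mod_cast h2
  have hcard : Fintype.card (Module.Free.ChooseBasisIndex ℤ (𝓞 F)) = 2 := by
    rw [← Module.finrank_eq_card_chooseBasisIndex, NumberField.RingOfIntegers.rank, hrank]
  let b : Module.Basis (Fin 2) ℤ (𝓞 F) :=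
    (NumberField.RingOfIntegers.basis F).reindex (Fintype.equivFinOfCardEq hcard)
  have hdisc := Algebra.discr_of_matrix_vecMul (b : Fin 2 → 𝓞 F) (b.toMatrix ![1, D])
  rw [Module.Basis.toMatrix_map_vecMul, NumberField.discr_eq_discr] at hdisc
  refine ⟨(b.toMatrix ![1, D]).det, ?_⟩
  have h1 : Algebra.trace ℤ (𝓞 F) 1 = 2 := by simpa using htr 1
  rw [← hdisc, Algebra.discr_def, Matrix.det_fin_two]
  simp [Algebra.traceMatrix_apply, Algebra.traceForm_apply, h1, htrD, hD, htr]
  ring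

theorem legendreSym_discr_eq {F : Type*} [Field F] [NumberField F] {d : ℤ}
    (hd : Squarefree d) (hd1 : d ≠ 1) {δ : F} (hδ : δ ^ 2 = d)
    (htop : IntermediateField.adjoin ℚ {δ} = ⊤) {p : ℕ} [Fact p.Prime] (hp : p ≠ 2) :
    legendreSym p (NumberField.discr F) = legendreSym p d := by
  obtain ⟨n, hn⟩ := exists_four_mul_eq_sq_mul_discr hd hd1 hδ htop
  have hpp : Prime (p : ℤ) := Nat.prime_iff_prime_int.1 Fact.out
  have h2 : ¬ (p : ℤ) ∣ 2 := fun h2 =>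
    hp ((Nat.prime_dvd_prime_iff_eq Fact.out Nat.prime_two).1 (by exact_mod_cast h2))
  -- Otherwise `p ^ 2` would divide `4 * d`, against squarefreeness.
  have hpn : ¬ (p : ℤ) ∣ n := by
    rintro ⟨m, rfl⟩
    have h4 : (p : ℤ) * p ∣ 2 ^ 2 * d := ⟨m ^ 2 * NumberField.discr F, by linear_combination hn⟩
    have hco : IsCoprime ((p : ℤ) * p) (2 ^ 2) :=
      have := ((Prime.coprime_iff_not_dvd hpp).2 h2).pow_right (n := 2)
      this.mul_left this
    exact hpp.not_isUnit (hd p (hco.dvd_of_dvd_mul_left h4))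
  have hsq {k : ℤ} (hk : ¬ (p : ℤ) ∣ k) : legendreSym p (k ^ 2) = 1 := by
    apply legendreSym.sq_one'
    rwa [Ne, ZMod.intCast_zmod_eq_zero_iff_dvd]
  have h := congrArg (legendreSym p) hn
  rw [show (4 : ℤ) = 2 ^ 2 by norm_num, legendreSym.mul, legendreSym.mul, hsq h2, hsq hpn] at h
  linarith

/-! ### Values over `F` and the conclusion -/

theorem exists_sq_sub_mul_sq_eq_neg_one {F : Type*} [Field F] [CharZero F] {d m s t x y z : ℤ}
    {p : ℕ} (hp : p ≠ 0) (hd : d ≠ 0) {δ : F} (hδ : δ ^ 2 = d) (hm : m = s ^ 2 + t ^ 2)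
    (hm0 : 0 < m) (hne : ¬ (x = 0 ∧ y = 0 ∧ z = 0)) (h : x ^ 2 + d * y ^ 2 = p * m * z ^ 2) :
    ∃ u v : F, u ^ 2 - p * v ^ 2 = -1 := by
  have hpF : (p : F) ≠ 0 := Nat.cast_ne_zero.2 hp
  have hδ0 : δ ≠ 0 := by
    rintro rfl
    exact hd (by exact_mod_cast (hδ.symm.trans (by ring) : (d : F) = 0))
  have hmF : (m : F) = s ^ 2 + t ^ 2 := by exact_mod_cast congrArg ((↑) : ℤ → F) hm
  have hm0F : (m : F) ≠ 0 := by exact_mod_cast hm0.ne'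
  have hF : (x : F) ^ 2 + d * y ^ 2 = p * m * z ^ 2 := by exact_mod_cast congrArg ((↑) : ℤ → F) h
  -- Brahmagupta's identity for `(x² + (δy)²)(s² + t²)`. If `B ≠ 0`, dividing by `B²` gives `-1`; if
  -- `B = 0`, then `p` is a square and the form is universal.
  obtain ⟨A, hA⟩ : ∃ A : F, A = x * s + δ * y * t := ⟨_, rfl⟩
  obtain ⟨B, hB⟩ : ∃ B : F, B = x * t - δ * y * s := ⟨_, rfl⟩
  have hAB : A ^ 2 + B ^ 2 = p * (m * z) ^ 2 := by
    rw [hA, hB]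
    linear_combination (s ^ 2 + t ^ 2 : F) * y ^ 2 * hδ + (s ^ 2 + t ^ 2 : F) * hF -
      (p * m * z ^ 2 : F) * hmF
  by_cases hB0 : B = 0
  · rw [hB0] at hAB
    by_cases hz : z = 0
    · exfalso
      have hA0 : A = 0 := by simpa [hz] using hAB
      have h1 : (m : F) * x = 0 := by
        linear_combination s * (hA0 - hA) + t * (hB0 - hB) + x * hmF
      have h2 : (m : F) * δ * y = 0 := by
        linear_combination t * (hA0 - hA) - s * (hB0 - hB) + δ * y * hmF
      have hx : x = 0 := by simpa [hm0F] using h1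
      have hy : y = 0 := by simpa [hm0F, hδ0] using h2
      exact hne ⟨hx, hy, hz⟩
    · have hzF : (z : F) ≠ 0 := by exact_mod_cast hz
      refine exists_sq_sub_mul_sq_of_isSquare two_ne_zero hpF ⟨A / (m * z), ?_⟩ _
      field_simp
      linear_combination -hAB
  · refine ⟨A / B, m * z / B, ?_⟩
    field_simp
    linear_combination hAB

theorem exists_sq_sub_mul_sq_eq_natCast {F : Type*} [Field F] [CharZero F] {p q : ℕ}
    [Fact p.Prime] [Fact q.Prime] (hpq : p ≠ q) (hp : p % 4 = 3) (hq : q % 4 = 3)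
    (hqp : legendreSym p q = -1) (h : ∃ u v : F, u ^ 2 - p * v ^ 2 = -1) :
    ∃ u v : F, u ^ 2 - p * v ^ 2 = q := by
  have hpp : p.Prime := Fact.out
  have hqq : q.Prime := Fact.out
  have hpF : (p : F) ≠ 0 := Nat.cast_ne_zero.2 hpp.ne_zero
  rw [jacobiSym.legendreSym.to_jacobiSym] at hqp
  obtain ⟨a, ha⟩ : ∃ a : ℤ, (p : ℤ) ∣ a ^ 2 - -q := exists_dvd_sq_sub_of_jacobiSym (by
    rw [jacobiSym.neg _ (Nat.odd_iff.2 (by omega)), ZMod.χ₄_nat_three_mod_four hp, hqp]; rfl)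
  obtain ⟨c, hc⟩ : ∃ c : ℤ, (q : ℤ) ∣ c ^ 2 - p := exists_dvd_sq_sub_of_jacobiSym (by
    rw [jacobiSym.quadratic_reciprocity_three_mod_four hp hq, hqp]; rfl)
  -- Since `(q/p) = -1` and both primes are `3` modulo `4`, `(-q/p) = (p/q) = 1`, which are the
  -- conditions for `q Y² + Z² = p X²`.
  obtain ⟨Y, Z, X, hne, hXYZ⟩ := legendre_ternary (a := q) (b := 1) (c := p) hqq.squarefree
    squarefree_one hpp.squarefree (Nat.coprime_one_right q) (Nat.coprime_one_left p)
    ((Nat.coprime_primes hqq hpp).2 hpq.symm) (u := a) (v := c) (w := 0)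
    (by simpa using ha) (by simpa using hc) (by simp)
  have hF : (q : F) * Y ^ 2 + Z ^ 2 = p * X ^ 2 := by
    have := congrArg ((↑) : ℤ → F) hXYZ
    push_cast at this
    linear_combination this
  obtain ⟨u, v, huv⟩ := h
  by_cases hY : Y = 0
  · have hX : X ≠ 0 := by
      rintro rfl
      refine hne ⟨hY, ?_, rfl⟩
      simpa [hY] using hXYZ
    have hXF : (X : F) ≠ 0 := by exact_mod_cast hX
    refine exists_sq_sub_mul_sq_of_isSquare two_ne_zero hpF ⟨Z / X, ?_⟩ _
    rw [hY] at hF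
    push_cast at hF
    field_simp
    linear_combination -hF
  · have hYF : (Y : F) ≠ 0 := by exact_mod_cast hY
    have e : (u * Y) ^ 2 - p * (v * Y) ^ 2 = -(Y : F) ^ 2 := by
      linear_combination (Y : F) ^ 2 * huv
    refine exists_sq_sub_mul_sq_of_mul (x := (Z : F)) (y := X) (z := u * Y) (w := v * Y) ?_ ?_
    · rw [e]
      exact neg_ne_zero.2 (pow_ne_zero 2 hYF)
    · rw [e]
      linear_combination hF

theorem odd_finrank_of_isDihedralOver_or {F K : Type*} [Field F] [NumberField F] [Field K]
    [NumberField K] [Algebra F K] {ℓ : ℕ} (hℓ : Odd ℓ)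
    (hK : IsDihedralOver F K ℓ ∨ IsUnramifiedAbelianEllExtension F K ℓ) :
    Odd (Module.finrank F K) := by
  rcases hK with ⟨-, -, h⟩ | ⟨-, -, ⟨n, -, h⟩, -⟩
  · rwa [h]
  · rw [h]
    exact hℓ.pow

theorem mainTheorem4 (d : ℤ) (hd : Squarefree d) (hd1 : d ≠ 1)
    (F : Type*) [Field F] [NumberField F] (hF : IsRatAdjoinSqrt F d)
    (ℓ : ℕ) (hℓ : ℓ.Prime) (hℓodd : Odd ℓ)
    (K : Type*) [Field K] [NumberField K] [Algebra F K]
    (hK : IsDihedralOver F K ℓ ∨ IsUnramifiedAbelianEllExtension F K ℓ)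
    (p q : ℕ) [Fact p.Prime] [Fact q.Prime] (hpq : p ≠ q)
    (hp : p ≡ 3 [MOD 4]) (hq : q ≡ 3 [MOD 4]) (hqp : legendreSym p (q : ℤ) ≠ 1) :
    IsDivisionAlgebra ℍ[K, (p : K), (q : K)] ↔
      legendreSym p (NumberField.discr F) = 1 ∨ d ≡ 1 [ZMOD 8] := by
  have hpp : p.Prime := Fact.out
  have hqq : q.Prime := Fact.out
  have hp4 : p % 4 = 3 := hp
  have hq4 : q % 4 = 3 := hq
  have hp2 : p ≠ 2 := by omega
  obtain ⟨δ, hδ, htop⟩ := hF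
  have hqp' : legendreSym p q = -1 := by
    refine (legendreSym.eq_one_or_neg_one p ?_).resolve_left hqp
    rw [Int.cast_natCast, Ne, ZMod.natCast_eq_zero_iff]
    exact fun h => hpq ((Nat.prime_dvd_prime_iff_eq hpp hqq).1 h)
  rw [isDivisionAlgebra_quaternionAlgebra_iff two_ne_zero (Nat.cast_ne_zero.2 hpp.ne_zero),
    legendreSym_discr_eq hd hd1 hδ htop hp2, ← map_natCast (algebraMap F K) p,
    ← map_natCast (algebraMap F K) q,
    exists_sq_sub_mul_sq_iff_of_odd_finrank (odd_finrank_of_isDihedralOver_or hℓodd hK)]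
  constructor
  · intro h
    by_contra! hcon
    obtain ⟨m, s, t, hm, hm0, x, y, z, hne, hxyz⟩ := exists_mul_sum_two_squares hd hp4
      (by rw [← jacobiSym.legendreSym.to_jacobiSym]; exact hcon.1) hcon.2
    exact h (exists_sq_sub_mul_sq_eq_natCast hpq hp4 hq4 hqp'
      (exists_sq_sub_mul_sq_eq_neg_one hpp.ne_zero hd.ne_zero hδ hm hm0 hne hxyz))
  · rintro (h | h) ⟨x, y, hxy⟩
    · obtain ⟨s, hs⟩ := Padic.exists_sq_eq_of_legendreSym hp2 h
      obtain ⟨f⟩ := exists_ringHom_of_sq_eq hd hd1 hδ htop hs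
      exact Padic.sq_sub_prime_mul_sq_ne hqp' (f x) (f y) (by simpa using congrArg f hxy)
    · obtain ⟨s, hs⟩ := Padic.exists_sq_eq_of_one_mod_eight h
      obtain ⟨f⟩ := exists_ringHom_of_sq_eq hd hd1 hδ htop hs
      exact Padic.two_sq_sub_mul_sq_ne hp4 hq4 (f x) (f y) (by simpa using congrArg f hxy)
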